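/- Let $\Gamma$ be a countable group and let $(X,T)$ be a $\Gamma$-dynamical system: $X$ is a compact metric space and $T:\Gamma\to\mathrm{Homeo}(X)$, $\gamma\mapsto T_\gamma$, is a group homomorphism. Let $\mathrm{Prob}(X,T)$ be the set of $T$-invariant Borel probability measures on $X$ and let $\mathrm{Cov}(X)$ be the set of finite open covers of $X$. Write $\mathcal V\succeq\mathcal U$ if every element of $\mathcal V$ is contained in some element of $\mathcal U$. Define $$\dim(X,T)=\sup_{\mathcal U\in\mathrm{Cov}(X)}\ \inf_{\substack{\mathcal V\in\mathrm{Cov}(X)\\ \mathcal V\succeq\mathcal U}}\ \sup_{\mu\in\mathrm{Prob}(X,T)}\int_X\Big(-1+\sum_{V\in\mathcal V}\mathbf 1_V(x)\Big)\,d\mu(x)\in[-\infty,+\infty],$$ with $\dim(X,T)=-\infty$ if $\mathrm{Prob}(X,T)=\emptyset$. For $d\in\mathbb N=\{0,1,2,\dots\}$ let $\Gamma$ act on $([0,1]^d)^\Gamma$ (with the product topology) by the left shift $(\mathrm{shift}_\gamma(y))_{\gamma'}=y_{\gamma^{-1}\gamma'}$, and for $f\in C(X,[0,1]^d)$ let $f^\Gamma:X\to([0,1]^d)^\Gamma$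 be given by $f^\Gamma(x)_\gamma=f(T_{\gamma^{-1}}(x))$. A continuous equivariant map $\pi:X\to Y$ between $\Gamma$-dynamical systems $(X,T)$ and $(Y,S)$ is called an almost embedding if for every $\mu\in\mathrm{Prob}(X,T)$ it induces a measure-theoretic isomorphism of $(X,T,\mu)$ and $(Y,S,\pi_*\mu)$, that is, there are invariant Borel sets $X_0\subseteq X$ and $Y_0\subseteq Y$ with $\mu(X_0)=1=\pi_*\mu(Y_0)$ such that $\pi$ restricts to a bijection $X_0\to Y_0$ which is measurable with measurable inverse. Theorem. If $\dim(X,T)<\frac d2$, then there is a dense $G_\delta$ set $G\subseteq C(X,[0,1]^d)$ (in the topology of uniform convergence) such that for every $f\in G$ the map $f^\Gamma:X\to([0,1]^d)^\Gamma$ is an almost embedding of $(X,T)$ into $(([0,1]^d)^\Gamma,\mathrm{shift})$. -/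

import Mathlib

open MeasureTheory

namespace DynDim

section Dimension

variable {X : Type*} [TopologicalSpace X]

/-- `Cov X`: the finite open covers of `X`. -/
def Cov (X : Type*) [TopologicalSpace X] : Set (Finset (Set X)) :=
  {𝒰 | (∀ U ∈ 𝒰, IsOpen U) ∧ ∀ x : X, ∃ U ∈ 𝒰, x ∈ U}

/-- `Refines 𝒱 𝒰` : every element of `𝒱` is contained in some element of `𝒰`. -/
def Refines (𝒱 𝒰 : Finset (Set X)) : Prop :=
  ∀ V ∈ 𝒱, ∃ U ∈ 𝒰, V ⊆ U

/-- `ord(𝒱, x) = -1 + ∑_{V ∈ 𝒱} 1_V(x)`. -/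
noncomputable def ordAt (𝒱 : Finset (Set X)) (x : X) : ℝ :=
  -1 + ∑ V ∈ 𝒱, V.indicator (fun _ => (1 : ℝ)) x

variable [MeasurableSpace X]

/-- `ord(𝒱, P) = sup_{μ ∈ P} ∫ ord(𝒱, x) dμ(x)`, an extended real.
For a finite collection of Borel sets the integrand is bounded and Borel, hence integrable. -/
noncomputable def ordOf (𝒱 : Finset (Set X)) (P : Set (ProbabilityMeasure X)) : EReal :=
  ⨆ μ ∈ P, ((∫ x, ordAt 𝒱 x ∂(μ : Measure X) : ℝ) : EReal)

/-- `dim(𝒰, P) = inf ord(𝒱, P)`, over the finite open covers `𝒱` refining `𝒰`. -/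
noncomputable def dimCover (𝒰 : Finset (Set X)) (P : Set (ProbabilityMeasure X)) : EReal :=
  ⨅ 𝒱 ∈ {𝒱 ∈ Cov X | Refines 𝒱 𝒰}, ordOf 𝒱 P

/-- `dim(X, P) = sup_{𝒰 ∈ Cov X} dim(𝒰, P)`; see `dimPair_empty` for `P = ∅`. -/
noncomputable def dimPair (P : Set (ProbabilityMeasure X)) : EReal :=
  ⨆ 𝒰 ∈ Cov X, dimCover 𝒰 P

/-- The convention `dim(X, ∅) = -∞` holds automatically. -/
theorem dimPair_empty : dimPair (∅ : Set (ProbabilityMeasure X)) = ⊥ := by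
  refine le_bot_iff.1 (iSup₂_le fun 𝒰 h => ?_)
  refine (iInf₂_le 𝒰 ⟨h, fun V hV => ⟨V, hV, subset_rfl⟩⟩).trans ?_
  simp [ordOf]

end Dimension

section Dynamics

variable {Γ : Type*} [Group Γ] {X : Type*} [TopologicalSpace X] {Y : Type*} [TopologicalSpace Y]

/-- `Prob(X, T)`: the `T`-invariant Borel probability measures on `X`. -/
def invProb [MeasurableSpace X] (T : Γ →* (X ≃ₜ X)) : Set (ProbabilityMeasure X) :=
  {μ | ∀ γ : Γ, Measure.map (T γ) (μ : Measure X) = (μ : Measure X)}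

/-- `dim(X, T) = dim(X, Prob(X, T))`. -/
noncomputable def dimSys [MeasurableSpace X] (T : Γ →* (X ≃ₜ X)) : EReal :=
  dimPair (invProb T)

/-- `f` induces a measure-theoretic isomorphism from `(X, T, μ)` onto `(Y, S, f_* μ)`: it restricts
to an equivariant bi-measurable bijection between invariant measurable sets of full measure.
(The restriction carries `μ` to `f_* μ` by definition of the latter.) -/
def InducesMeasureIso [MeasurableSpace X] [MeasurableSpace Y]
    (T : Γ →* (X ≃ₜ X)) (S : Γ →* (Y ≃ₜ Y)) (μ : Measure X) (f : X → Y) : Prop :=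
  Measurable f ∧
    ∃ (X₀ : Set X) (Y₀ : Set Y),
      MeasurableSet X₀ ∧ MeasurableSet Y₀ ∧
      μ X₀ᶜ = 0 ∧ (Measure.map f μ) Y₀ᶜ = 0 ∧
      (∀ γ : Γ, T γ '' X₀ = X₀) ∧ (∀ γ : Γ, S γ '' Y₀ = Y₀) ∧
      (∀ γ : Γ, ∀ x ∈ X₀, f (T γ x) = S γ (f x)) ∧
      ∃ e : X₀ ≃ᵐ Y₀, ∀ x : X₀, (e x : Y) = f x

/-- Almost embedding of `(X, T)` into `(Y, S)`: a continuous equivariant map inducing a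
measure-theoretic isomorphism with respect to every invariant probability measure. -/
structure IsAlmostEmbedding [MeasurableSpace X] [MeasurableSpace Y]
    (T : Γ →* (X ≃ₜ X)) (S : Γ →* (Y ≃ₜ Y)) (f : X → Y) : Prop where
  continuous : Continuous f
  equivariant : ∀ (γ : Γ) (x : X), f (T γ x) = S γ (f x)
  measureIso : ∀ μ ∈ invProb T, InducesMeasureIso T S (μ : Measure X) f

/-- The left shift action of `Γ` on `K^Γ`: `(shift_γ x)_{γ'} = x_{γ⁻¹ γ'}`. -/
def shift (Γ : Type*) [Group Γ] (K : Type*) [TopologicalSpace K] :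
    Γ →* ((Γ → K) ≃ₜ (Γ → K)) where
  toFun γ :=
    { toFun := fun x γ' => x (γ⁻¹ * γ')
      invFun := fun x γ' => x (γ * γ')
      left_inv := fun x => by funext γ'; simp
      right_inv := fun x => by funext γ'; simp
      continuous_toFun := by fun_prop
      continuous_invFun := by fun_prop }
  map_one' := by ext x γ'; simp
  map_mul' γ₁ γ₂ := by ext x γ'; simp [mul_assoc]

/-- `f^Γ : X → K^Γ`, `f^Γ(x)_γ = f(T_{γ⁻¹} x)`; with the left shift on `K^Γ` this is the
equivariant map whose coordinate at the identity is `f`. -/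
def orbitMap {K : Type*} (T : Γ →* (X ≃ₜ X)) (f : X → K) : X → (Γ → K) :=
  fun x γ => f (T γ⁻¹ x)

end Dynamics

end DynDim

/-!
Call a continuous map `f` good at scale `ε` if, for some finite open cover `𝒱` of order less than
`c < d / 2` with respect to all invariant measures, `f` separates any two `ε`-distant points whose
orders in `𝒱` add up to less than `d`. Two such points lie in at most `d + 1` elements of `𝒱`
altogether, so a partition of unity subordinate to `𝒱` with vertices in general position in the
cube yields good maps close to any given map. Being good is also an open condition, so a generic `f`
is good at every scale.

For such `f` and an invariant measure `μ`, form the relatively independent self-joining of `μ` over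
`f^Γ`. If it charged the complement of the diagonal, its normalized restriction there would be an
invariant measure with invariant marginals, carried by pairs with equal images under `f`. By
Markov's inequality, pairs of total order less than `d` have probability at least `1 - 2c/d > 0`,
and goodness puts them within `ε` of the diagonal; letting `ε → 0`, the diagonal itself has positive
mass, a contradiction. Hence the self-joining lives on the diagonal, and the conditional measures of
`μ` over `f^Γ` are Dirac masses.
-/

namespace DynDim

section GeneralPosition

variable {ι E : Type*}

theorem affineSpan_image_ne_top_of_card_le {k V : Type*} [DivisionRing k] [AddCommGroup V]
    [Module k V] {p : ι → V} {t : Finset ι} (ht : t.card ≤ Module.finrank k V) :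
    affineSpan k (p '' t) ≠ ⊤ := by
  classical
  intro htop
  obtain ⟨n, hn⟩ : ∃ n, t.card = n + 1 :=
    Nat.exists_eq_add_one.2 <| Finset.card_pos.2 <| Finset.nonempty_iff_ne_empty.2 <| by
      rintro rfl
      simp at htop
  have hle := finrank_vectorSpan_image_finset_le k p t hn
  rw [← direction_affineSpan, Finset.coe_image, htop, AffineSubspace.direction_top,
    finrank_top] at hle
  omega

section AffineIndependence

variable [AddCommGroup E] [Module ℝ E]

/-- The points `p i`, `i ∈ s`, of a finite-dimensional real vector space are in general position:
any `dim E + 1` or fewer of them are affinely independent. -/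
def InGeneralPositionOn (p : ι → E) (s : Finset ι) : Prop :=
  ∀ t ⊆ s, t.card ≤ Module.finrank ℝ E + 1 → AffineIndependent ℝ fun i : t => p i

theorem InGeneralPositionOn.eq_of_sum_smul_eq {p : ι → E} {s : Finset ι}
    (hp : InGeneralPositionOn p s) {v w : ι → ℝ}
    (hsum : ∑ i ∈ s, v i = ∑ i ∈ s, w i) (hcomb : ∑ i ∈ s, v i • p i = ∑ i ∈ s, w i • p i)
    {t : Finset ι} (hts : t ⊆ s) (hcard : t.card ≤ Module.finrank ℝ E + 1)
    (hv : ∀ i ∈ s, i ∉ t → v i = 0) (hw : ∀ i ∈ s, i ∉ t → w i = 0) :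
    ∀ i ∈ s, v i = w i := by
  have hvw : ∀ i ∈ s, i ∉ t → v i - w i = 0 := fun i hi hit => by
    rw [hv i hi hit, hw i hi hit, sub_zero]
  have hsum_t : ∑ i : t, (v i - w i) = 0 := by
    rw [Finset.sum_coe_sort t fun i => v i - w i, Finset.sum_subset hts hvw,
      Finset.sum_sub_distrib, sub_eq_zero, hsum]
  have hcomb_t : ∑ i : t, (v i - w i) • p i = 0 := by
    rw [Finset.sum_coe_sort t fun i => (v i - w i) • p i,
      Finset.sum_subset hts fun i hi hit => by rw [hvw i hi hit, zero_smul]]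
    simp_rw [sub_smul]
    rw [Finset.sum_sub_distrib, sub_eq_zero, hcomb]
  intro i hi
  by_cases hit : i ∈ t
  · exact sub_eq_zero.1 <| affineIndependent_iff.1 (hp t hts hcard) Finset.univ _ hsum_t hcomb_t
      ⟨i, hit⟩ (Finset.mem_univ _)
  · rw [hv i hi hit, hw i hi hit]

theorem InGeneralPositionOn.insert [DecidableEq ι] {p : ι → E} {s : Finset ι} {a : ι}
    (hp : InGeneralPositionOn p s)
    (ha : ∀ t ⊆ s, t.card ≤ Module.finrank ℝ E → p a ∉ affineSpan ℝ (p '' t)) :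
    InGeneralPositionOn p (insert a s) := by
  intro t hts hcard
  have hes : t.erase a ⊆ s := Finset.subset_insert_iff.1 hts
  by_cases hat : a ∈ t
  · have hcard' : (t.erase a).card ≤ Module.finrank ℝ E := by
      rw [Finset.card_erase_of_mem hat]
      omega
    let e : {i : t // i ≠ ⟨a, hat⟩} ↪ ↥(t.erase a) :=
      ⟨fun i => ⟨i.1, Finset.mem_erase.2 ⟨fun h => i.2 (Subtype.ext h), i.1.2⟩⟩,
        fun i j h => Subtype.ext (Subtype.ext (Subtype.mk.inj h))⟩
    have himage : (fun i : t => p i) '' {i | i ≠ ⟨a, hat⟩} = p '' (t.erase a) := by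
      ext y
      constructor
      · rintro ⟨i, hi, rfl⟩
        exact ⟨i, (e ⟨i, hi⟩).2, rfl⟩
      · rintro ⟨i, hi, rfl⟩
        exact ⟨⟨i, Finset.mem_of_mem_erase hi⟩,
          fun h => Finset.ne_of_mem_erase hi (congrArg Subtype.val h), rfl⟩
    refine AffineIndependent.affineIndependent_of_notMem_span (i := ⟨a, hat⟩)
      ((hp (t.erase a) hes (by omega)).comp_embedding e) ?_
    rw [himage]
    exact ha _ hes hcard'
  · rw [← Finset.erase_eq_of_notMem hat] at hcard ⊢
    exact hp _ hes hcard

end AffineIndependence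

variable [NormedAddCommGroup E] [NormedSpace ℝ E] [FiniteDimensional ℝ E]

theorem exists_mem_forall_notMem_affineSubspace {U : Set E} (hU : IsOpen U) (hne : U.Nonempty)
    {𝒮 : Set (AffineSubspace ℝ E)} (hcount : 𝒮.Countable) (htop : ∀ S ∈ 𝒮, S ≠ ⊤) :
    ∃ x ∈ U, ∀ S ∈ 𝒮, x ∉ S := by
  borelize E
  have hnull : Measure.addHaar (⋃ S ∈ 𝒮, (S : Set E)) = 0 :=
    (measure_biUnion_null_iff hcount).2 fun S hS => Measure.addHaar_affineSubspace _ S (htop S hS)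
  by_contra! hcover
  refine (hU.measure_pos Measure.addHaar hne).ne' (measure_mono_null (fun x hx => ?_) hnull)
  simpa using hcover x hx

theorem exists_inGeneralPositionOn (s : Finset ι) {U : ι → Set E}
    (hU : ∀ i, IsOpen (U i)) (hne : ∀ i, (U i).Nonempty) :
    ∃ p : ι → E, (∀ i, p i ∈ U i) ∧ InGeneralPositionOn p s := by
  classical
  induction s using Finset.induction_on with
  | empty =>
    refine ⟨fun i => (hne i).some, fun i => (hne i).some_mem, fun t ht _ => ?_⟩
    have : IsEmpty t := Finset.isEmpty_coe_sort.2 (Finset.subset_empty.1 ht)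
    exact affineIndependent_of_subsingleton ℝ _
  | insert a s ha ih =>
    obtain ⟨p, hpU, hp⟩ := ih
    obtain ⟨x, hxU, hx⟩ := exists_mem_forall_notMem_affineSubspace (hU a) (hne a)
      (𝒮 := (fun t : Finset ι => affineSpan ℝ (p '' t)) ''
        {t | t ⊆ s ∧ t.card ≤ Module.finrank ℝ E})
      (((s.powerset.finite_toSet.subset fun t ht => Finset.mem_powerset.2 ht.1).image _).countable)
      (by
        rintro _ ⟨t, ⟨-, ht⟩, rfl⟩
        exact affineSpan_image_ne_top_of_card_le ht)
    have hps : ∀ t ⊆ s, Set.EqOn (Function.update p a x) p t := fun t hts i hi =>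
      Function.update_of_ne (ne_of_mem_of_not_mem (hts hi) ha) _ _
    refine ⟨Function.update p a x, fun i => ?_, InGeneralPositionOn.insert ?_ ?_⟩
    · rcases eq_or_ne i a with rfl | h
      · simpa using hxU
      · simpa [h] using hpU i
    · intro t hts hcard
      convert hp t hts hcard using 2 with i
      exact hps t hts i.2
    · intro t hts hcard
      rw [Function.update_self, (hps t hts).image_eq]
      exact hx _ ⟨t, ⟨hts, hcard⟩, rfl⟩

theorem exists_inGeneralPositionOn_dist_lt (s : Finset ι) {K : Set E} (hK : Convex ℝ K)
    (hint : (interior K).Nonempty) {X : Type*} {f : X → E} (hf : ∀ x, f x ∈ K) {A : ι → Set X}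
    {δ : ℝ} (hδ : 0 < δ) (hosc : ∀ i, ∀ x ∈ A i, ∀ y ∈ A i, dist (f x) (f y) < δ) :
    ∃ p : ι → E, InGeneralPositionOn p s ∧ (∀ i, p i ∈ K) ∧
      ∀ i, ∀ x ∈ A i, dist (p i) (f x) < 2 * δ := by
  have hcenter : ∀ i, ∃ q ∈ K, ∀ x ∈ A i, dist q (f x) < δ := fun i => by
    rcases (A i).eq_empty_or_nonempty with hi | ⟨y, hy⟩
    · exact ⟨hint.some, interior_subset hint.some_mem, by simp [hi]⟩
    · exact ⟨f y, hf y, hosc i y hy⟩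
  choose q hqK hq using hcenter
  have hclosure : ∀ i, q i ∈ closure (interior K) := fun i => by
    rw [hK.closure_interior_eq_closure_of_nonempty_interior hint]
    exact subset_closure (hqK i)
  obtain ⟨p, hpU, hp⟩ := exists_inGeneralPositionOn s
    (U := fun i => Metric.ball (q i) δ ∩ interior K)
    (fun i => Metric.isOpen_ball.inter isOpen_interior)
    fun i => mem_closure_iff.1 (hclosure i) _ Metric.isOpen_ball (Metric.mem_ball_self hδ)
  refine ⟨p, hp, fun i => interior_subset (hpU i).2, fun i x hx => ?_⟩
  linarith [dist_triangle (p i) (q i) (f x), Metric.mem_ball.1 (hpU i).1, hq i x hx]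

end GeneralPosition

section Order

variable {X : Type*} {𝒱 : Finset (Set X)}

open Classical in
theorem ordAt_eq_card (𝒱 : Finset (Set X)) (x : X) :
    ordAt 𝒱 x = -1 + ((𝒱.filter (x ∈ ·)).card : ℝ) := by
  simp [ordAt, Set.indicator_apply]

theorem ordAt_nonneg (hcover : ∀ x, ∃ V ∈ 𝒱, x ∈ V) (x : X) : 0 ≤ ordAt 𝒱 x := by
  classical
  obtain ⟨V, hV, hx⟩ := hcover x
  have hpos : 0 < (𝒱.filter (x ∈ ·)).card := Finset.card_pos.2 ⟨V, Finset.mem_filter.2 ⟨hV, hx⟩⟩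
  rw [ordAt_eq_card, neg_add_eq_sub, sub_nonneg]
  exact_mod_cast hpos

open Classical in
theorem card_filter_mem_or_mem_le_of_ordAt_add_lt {x y : X} {n : ℕ}
    (h : ordAt 𝒱 x + ordAt 𝒱 y < n) : (𝒱.filter fun V => x ∈ V ∨ y ∈ V).card ≤ n + 1 := by
  rw [ordAt_eq_card, ordAt_eq_card] at h
  have hlt : (𝒱.filter (x ∈ ·)).card + (𝒱.filter (y ∈ ·)).card < n + 2 := by
    rify
    linarith
  rw [Finset.filter_or]
  exact (Finset.card_union_le _ _).trans (by omega)

theorem eventually_ordAt_le [TopologicalSpace X] (hopen : ∀ V ∈ 𝒱, IsOpen V) (x : X) :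
    ∀ᶠ x' in nhds x, ordAt 𝒱 x ≤ ordAt 𝒱 x' := by
  classical
  have hmem : ∀ V ∈ 𝒱, ∀ᶠ x' in nhds x, x ∈ V → x' ∈ V := fun V hV => by
    by_cases hx : x ∈ V
    · filter_upwards [(hopen V hV).mem_nhds hx] with x' hx' _ using hx'
    · exact .of_forall fun x' hxV => absurd hxV hx
  filter_upwards [(Finset.eventually_all 𝒱).2 hmem] with x' hx'
  rw [ordAt_eq_card, ordAt_eq_card]
  gcongr with V hV
  exact hx' V hV

theorem integrable_ordAt [MeasurableSpace X] (hmeas : ∀ V ∈ 𝒱, MeasurableSet V) (μ : Measure X)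
    [IsFiniteMeasure μ] : Integrable (ordAt 𝒱) μ :=
  (integrable_const _).add <| integrable_finsetSum _ fun V hV =>
    (integrable_const _).indicator (hmeas V hV)

theorem exists_refines_ordOf_lt [TopologicalSpace X] [MeasurableSpace X]
    {P : Set (ProbabilityMeasure X)} {c : EReal} (hP : dimPair P < c) {𝒰 : Finset (Set X)}
    (h𝒰 : 𝒰 ∈ Cov X) : ∃ 𝒱 ∈ Cov X, Refines 𝒱 𝒰 ∧ ordOf 𝒱 P < c := by
  have hlt : dimCover 𝒰 P < c := (le_iSup₂ (f := fun 𝒰 _ => dimCover 𝒰 P) 𝒰 h𝒰).trans_lt hP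
  simpa [dimCover, iInf_lt_iff, and_assoc] using hlt

end Order

section Separation

variable {X : Type*} [MetricSpace X]

/-- Points `x, y` with `ord(𝒱, x) + ord(𝒱, y) < r` and the same image under `f` are at distance
less than `ε`. -/
def Separates {K : Type*} (f : X → K) (𝒱 : Finset (Set X)) (r ε : ℝ) : Prop :=
  ∀ x y, ordAt 𝒱 x + ordAt 𝒱 y < r → f x = f y → dist x y < ε

theorem isOpen_separates [CompactSpace X] {K : Type*} [TopologicalSpace K] [T2Space K]
    {𝒱 : Finset (Set X)} (hopen : ∀ V ∈ 𝒱, IsOpen V) (r ε : ℝ) :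
    IsOpen {f : C(X, K) | Separates f 𝒱 r ε} := by
  have hlarge : IsOpen {q : X × X | r ≤ ordAt 𝒱 q.1 + ordAt 𝒱 q.2} := by
    refine isOpen_iff_mem_nhds.2 fun q hq => ?_
    filter_upwards [continuousAt_fst.eventually (eventually_ordAt_le hopen q.1),
      continuousAt_snd.eventually (eventually_ordAt_le hopen q.2)] with q' h₁ h₂
    exact le_trans hq (add_le_add h₁ h₂)
  have hcompact : IsCompact
      ({q : X × X | r ≤ ordAt 𝒱 q.1 + ordAt 𝒱 q.2}ᶜ ∩ {q | ε ≤ dist q.1 q.2}) :=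
    (hlarge.isClosed_compl.inter (isClosed_le continuous_const continuous_dist)).isCompact
  have hprod : Continuous fun f : C(X, K) => f.prodMap f :=
    ContinuousMap.continuous_of_continuous_uncurry _ <| by
      change Continuous fun q : C(X, K) × (X × X) => (q.1 q.2.1, q.1 q.2.2)
      fun_prop
  convert (ContinuousMap.isOpen_setOfPred_mapsTo hcompact
    (isClosed_diagonal (X := K)).isOpen_compl).preimage hprod using 1
  ext f
  simp only [Set.mem_ofPred_eq, Set.mem_preimage, Separates, Set.MapsTo, Prod.forall,
    Set.mem_inter_iff, Set.mem_compl_iff, not_le, Set.mem_diagonal_iff,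
    ContinuousMap.prodMap_apply, Prod.map]
  exact forall₂_congr fun x y => by grind

theorem separates_finsum_smul {E : Type*} [AddCommGroup E] [Module ℝ E] {𝒱 : Finset (Set X)}
    {ε : ℝ} (hdist : ∀ V ∈ 𝒱, ∀ x ∈ V, ∀ y ∈ V, dist x y < ε) {φ : PartitionOfUnity 𝒱 X}
    (hφ : φ.IsSubordinate fun V => (V : Set X)) {p : 𝒱 → E}
    (hp : InGeneralPositionOn p Finset.univ) :
    Separates (fun x => ∑ᶠ V, φ V x • p V) 𝒱 (Module.finrank ℝ E) ε := by
  classical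
  intro x y hord hxy
  have hsupp : ∀ (V : 𝒱) z, φ V z ≠ 0 → z ∈ (V : Set X) := fun V z hz =>
    hφ V (subset_tsupport _ hz)
  have hsum : ∀ z, ∑ V, φ V z = 1 := fun z => by
    rw [← finsum_eq_sum_of_fintype, φ.sum_eq_one (Set.mem_univ z)]
  simp only [finsum_eq_sum_of_fintype] at hxy
  have hcard : (Finset.univ.filter fun V : 𝒱 => x ∈ (V : Set X) ∨ y ∈ (V : Set X)).card ≤
      Module.finrank ℝ E + 1 := by
    rw [← Finset.card_map (Function.Embedding.subtype _)]
    exact (Finset.card_le_card fun V => by simp +contextual).trans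
      (card_filter_mem_or_mem_le_of_ordAt_add_lt hord)
  have hweights : ∀ V ∈ Finset.univ, φ V x = φ V y :=
    hp.eq_of_sum_smul_eq ((hsum x).trans (hsum y).symm) hxy (Finset.filter_subset _ _) hcard
      (by grind) (by grind)
  obtain ⟨V, hV⟩ := φ.exists_pos (Set.mem_univ x)
  exact hdist V V.2 x (hsupp V x hV.ne') y (hsupp V y (hweights V (Finset.mem_univ V) ▸ hV.ne'))

theorem exists_separates_dist_lt {E : Type*} [NormedAddCommGroup E] [NormedSpace ℝ E]
    [FiniteDimensional ℝ E] {K : Set E} (hK : Convex ℝ K) (hint : (interior K).Nonempty)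
    {f : X → E} (hf : ∀ x, f x ∈ K) {𝒱 : Finset (Set X)} (h𝒱 : 𝒱 ∈ Cov X) {δ ε : ℝ}
    (hδ : 0 < δ) (hdist : ∀ V ∈ 𝒱, ∀ x ∈ V, ∀ y ∈ V, dist x y < ε)
    (hosc : ∀ V ∈ 𝒱, ∀ x ∈ V, ∀ y ∈ V, dist (f x) (f y) < δ) :
    ∃ g : C(X, E), (∀ x, g x ∈ K) ∧ (∀ x, dist (g x) (f x) < 2 * δ) ∧
      Separates g 𝒱 (Module.finrank ℝ E) ε := by
  obtain ⟨p, hp, hpK, hpf⟩ := exists_inGeneralPositionOn_dist_lt Finset.univ hK hint hf hδ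
    (A := fun V : 𝒱 => (V : Set X)) fun V => hosc V V.2
  obtain ⟨φ, hφ⟩ := PartitionOfUnity.exists_isSubordinate isClosed_univ
    (fun V : 𝒱 => (V : Set X)) (fun V => h𝒱.1 V V.2) fun x _ => by simpa using h𝒱.2 x
  refine ⟨⟨fun x => ∑ᶠ V, φ V x • p V, ?_⟩, fun x => ?_, fun x => ?_,
    separates_finsum_smul hdist hφ hp⟩
  · exact φ.continuous_finsum_smul fun V x _ => continuousAt_const
  · exact φ.finsum_smul_mem_convex (Set.mem_univ x) (g := fun V _ => p V) (fun V _ => hpK V) hK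
  · exact φ.finsum_smul_mem_convex (Set.mem_univ x) (g := fun V _ => p V)
      (fun V hV => Metric.mem_ball.2 (hpf V x (hφ V (subset_tsupport _ hV))))
      (convex_ball (f x) (2 * δ))

theorem exists_separates_unitCube_dist_lt [CompactSpace X] {d : ℕ}
    (f : C(X, Fin d → unitInterval)) {𝒱 : Finset (Set X)} (h𝒱 : 𝒱 ∈ Cov X) {δ ε : ℝ}
    (hδ : 0 < δ) (hdist : ∀ V ∈ 𝒱, ∀ x ∈ V, ∀ y ∈ V, dist x y < ε)
    (hosc : ∀ V ∈ 𝒱, ∀ x ∈ V, ∀ y ∈ V, dist (f x) (f y) < δ) :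
    ∃ g : C(X, Fin d → unitInterval), dist g f < 2 * δ ∧ Separates g 𝒱 d ε := by
  have hint : (interior (Set.Icc (0 : Fin d → ℝ) 1)).Nonempty := by
    rw [← Set.pi_univ_Icc, interior_pi_set Set.finite_univ]
    simp [Set.univ_pi_nonempty_iff]
  obtain ⟨g, hgK, hgf, hg⟩ := exists_separates_dist_lt (convex_Icc 0 1) hint
    (f := fun x j => (f x j : ℝ)) (fun x => ⟨fun j => (f x j).2.1, fun j => (f x j).2.2⟩) h𝒱 hδ
    hdist hosc
  refine ⟨⟨fun x j => ⟨g x j, (hgK x).1 j, (hgK x).2 j⟩, by fun_prop⟩,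
    (ContinuousMap.dist_lt_iff (by positivity)).2 hgf, fun x y hord hxy => ?_⟩
  rw [← Module.finrank_fin_fun ℝ (n := d)] at hord
  exact hg x y hord <| funext fun j => congrArg Subtype.val (congrFun hxy j)

theorem exists_mem_cov_dist_lt [CompactSpace X] {L : Type*} [PseudoMetricSpace L] (F : C(X, L))
    {ε : ℝ} (hε : 0 < ε) : ∃ 𝒰 ∈ Cov X, ∀ U ∈ 𝒰, ∀ x ∈ U, ∀ y ∈ U, dist (F x) (F y) < ε := by
  classical
  let W : X → Set X := fun x => F ⁻¹' Metric.ball (F x) (ε / 2)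
  have hopen : ∀ x, IsOpen (W x) := fun x => Metric.isOpen_ball.preimage F.continuous
  have hmem : ∀ x, x ∈ W x := fun x => Metric.mem_ball_self (half_pos hε)
  obtain ⟨t, ht⟩ := isCompact_univ.elim_finite_subcover W hopen
    fun x _ => Set.mem_iUnion.2 ⟨x, hmem x⟩
  refine ⟨t.image W, ⟨by simpa using fun x _ => hopen x, fun x => ?_⟩, ?_⟩
  · simpa using ht (Set.mem_univ x)
  · simp only [Finset.forall_mem_image]
    intro z _ x hx y hy
    linarith [dist_triangle_right (F x) (F y) (F z), Metric.mem_ball.1 hx, Metric.mem_ball.1 hy]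

end Separation

section Generic

variable {X : Type*} [MetricSpace X] [MeasurableSpace X]

/-- The continuous maps `f : X → K` for which some finite open cover `𝒱` with `ord(𝒱, P) < c` is
such that `f` takes distinct values at `ε`-distant points of total order less than `r`. -/
def separatingMaps (K : Type*) [TopologicalSpace K] (P : Set (ProbabilityMeasure X)) (c : EReal)
    (r ε : ℝ) : Set C(X, K) :=
  {f | ∃ 𝒱 ∈ Cov X, ordOf 𝒱 P < c ∧ Separates f 𝒱 r ε}

variable [CompactSpace X]

theorem isOpen_separatingMaps {K : Type*} [TopologicalSpace K] [T2Space K]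
    (P : Set (ProbabilityMeasure X)) (c : EReal) (r ε : ℝ) :
    IsOpen (separatingMaps K P c r ε) := by
  have hunion : separatingMaps K P c r ε = ⋃ 𝒱 ∈ {𝒱 ∈ Cov X | ordOf 𝒱 P < c},
      {f : C(X, K) | Separates f 𝒱 r ε} := by
    ext f
    simp [separatingMaps, and_assoc]
  rw [hunion]
  exact isOpen_biUnion fun 𝒱 h𝒱 => isOpen_separates h𝒱.1.1 r ε

theorem dense_separatingMaps {P : Set (ProbabilityMeasure X)} {c : EReal} (hP : dimPair P < c)
    (d : ℕ) {ε : ℝ} (hε : 0 < ε) : Dense (separatingMaps (Fin d → unitInterval) P c d ε) := by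
  refine Metric.dense_iff.2 fun f r hr => ?_
  obtain ⟨𝒰, h𝒰, hsmall⟩ := exists_mem_cov_dist_lt ((ContinuousMap.id X).prodMk f)
    (lt_min hε (half_pos hr))
  obtain ⟨𝒱, h𝒱, href, hord⟩ := exists_refines_ordOf_lt hP h𝒰
  have hsmall' : ∀ V ∈ 𝒱, ∀ x ∈ V, ∀ y ∈ V, dist x y < ε ∧ dist (f x) (f y) < r / 2 :=
    fun V hV x hx y hy => by
      obtain ⟨U, hU, hVU⟩ := href V hV
      have hxy := hsmall U hU x (hVU hx) y (hVU hy)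
      exact ⟨((le_max_left _ _).trans_lt hxy).trans_le (min_le_left _ _),
        ((le_max_right _ _).trans_lt hxy).trans_le (min_le_right _ _)⟩
  obtain ⟨g, hgf, hg⟩ := exists_separates_unitCube_dist_lt f h𝒱 (half_pos hr)
    (fun V hV x hx y hy => (hsmall' V hV x hx y hy).1)
    fun V hV x hx y hy => (hsmall' V hV x hx y hy).2
  exact ⟨g, Metric.mem_ball.2 (by linarith), 𝒱, h𝒱, hord, hg⟩

end Generic

section Joining

open Filter Topology

variable {X : Type*} [MeasurableSpace X] {P : Set (ProbabilityMeasure X)} {c : ℝ}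

theorem integral_ordAt_le_of_ordOf_lt {𝒱 : Finset (Set X)} (hord : ordOf 𝒱 P < c)
    {μ : ProbabilityMeasure X} (hμ : μ ∈ P) : ∫ x, ordAt 𝒱 x ∂(μ : Measure X) ≤ c :=
  EReal.coe_le_coe_iff.1 <| (le_iSup₂ (f := fun (μ : ProbabilityMeasure X) (_ : μ ∈ P) =>
    ((∫ x, ordAt 𝒱 x ∂(μ : Measure X) : ℝ) : EReal)) μ hμ).trans hord.le

theorem integral_ordAt_comp_le_of_ordOf_lt {𝒱 : Finset (Set X)}
    (hmeas : ∀ V ∈ 𝒱, MeasurableSet V) (hord : ordOf 𝒱 P < c) {μ : ProbabilityMeasure X}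
    (hμ : μ ∈ P) {Z : Type*} [MeasurableSpace Z] {ν : Measure Z} {π : Z → X}
    (hπ : MeasurePreserving π ν μ) : ∫ z, ordAt 𝒱 (π z) ∂ν ≤ c := by
  have hle := integral_ordAt_le_of_ordOf_lt hord hμ
  have hint : Integrable (ordAt 𝒱) (μ : Measure X) := integrable_ordAt hmeas _
  rw [← hπ.map_eq] at hle hint
  rwa [integral_map hπ.aemeasurable hint.aestronglyMeasurable] at hle

variable [MetricSpace X] {K : Type*} [TopologicalSpace K] {r : ℝ} {f : C(X, K)}
  {lam : Measure (X × X)} [IsProbabilityMeasure lam] {μ ν : ProbabilityMeasure X}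

theorem sub_le_mul_measureReal_dist_lt [OpensMeasurableSpace X] {ε : ℝ} (hr : 0 ≤ r)
    (hf : f ∈ separatingMaps K P c r ε) (hμ : μ ∈ P) (hν : ν ∈ P)
    (hfst : MeasurePreserving Prod.fst lam μ) (hsnd : MeasurePreserving Prod.snd lam ν)
    (hlam : ∀ᵐ q ∂lam, f q.1 = f q.2) :
    r - 2 * c ≤ r * lam.real {q | dist q.1 q.2 < ε} := by
  obtain ⟨𝒱, h𝒱, hord, hsep⟩ := hf
  have hmeas : ∀ V ∈ 𝒱, MeasurableSet V := fun V hV => (h𝒱.1 V hV).measurableSet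
  have hint_fst : Integrable (fun q : X × X => ordAt 𝒱 q.1) lam :=
    hfst.integrable_comp_of_integrable (integrable_ordAt hmeas _)
  have hint_snd : Integrable (fun q : X × X => ordAt 𝒱 q.2) lam :=
    hsnd.integrable_comp_of_integrable (integrable_ordAt hmeas _)
  have hnonneg : 0 ≤ᵐ[lam] fun q => ordAt 𝒱 q.1 + ordAt 𝒱 q.2 :=
    .of_forall fun q => add_nonneg (ordAt_nonneg h𝒱.2 q.1) (ordAt_nonneg h𝒱.2 q.2)
  have hmarkov : r * lam.real {q | r ≤ ordAt 𝒱 q.1 + ordAt 𝒱 q.2} ≤ 2 * c :=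
    calc r * lam.real {q | r ≤ ordAt 𝒱 q.1 + ordAt 𝒱 q.2}
        ≤ ∫ q, ordAt 𝒱 q.1 + ordAt 𝒱 q.2 ∂lam :=
          mul_meas_ge_le_integral_of_nonneg hnonneg (hint_fst.add hint_snd) r
      _ ≤ 2 * c := by
          rw [integral_add hint_fst hint_snd, two_mul]
          exact add_le_add (integral_ordAt_comp_le_of_ordOf_lt hmeas hord hμ hfst)
            (integral_ordAt_comp_le_of_ordOf_lt hmeas hord hν hsnd)
  have hcover : 1 ≤ lam.real {q | dist q.1 q.2 < ε} +
      lam.real {q | r ≤ ordAt 𝒱 q.1 + ordAt 𝒱 q.2} := by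
    rw [← probReal_univ (μ := lam)]
    refine (ENNReal.toReal_mono (measure_ne_top _ _) (measure_mono_ae ?_)).trans
      (measureReal_union_le _ _)
    filter_upwards [hlam] with q hq _
    exact (lt_or_ge (ordAt 𝒱 q.1 + ordAt 𝒱 q.2) r).imp_left fun hlt => hsep _ _ hlt hq
  linarith [mul_le_mul_of_nonneg_left hcover hr]

variable [SecondCountableTopology X] [OpensMeasurableSpace X]

theorem tendsto_measureReal_dist_lt_diagonal (ρ : Measure (X × X)) [IsFiniteMeasure ρ] :
    Tendsto (fun n : ℕ => ρ.real {q | dist q.1 q.2 < 1 / ((n : ℝ) + 1)}) atTop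
      (𝓝 (ρ.real (Set.diagonal X))) := by
  have hinter : ⋂ n : ℕ, {q : X × X | dist q.1 q.2 < 1 / ((n : ℝ) + 1)} = Set.diagonal X := by
    ext q
    simp only [Set.mem_iInter, Set.mem_ofPred_eq, Set.mem_diagonal_iff]
    constructor
    · intro h
      by_contra hne
      obtain ⟨n, hn⟩ := exists_nat_one_div_lt (dist_pos.2 hne)
      exact (hn.trans (h n)).false
    · intro h n
      rw [h, dist_self]
      exact Nat.one_div_pos_of_nat
  rw [← hinter]
  refine (ENNReal.tendsto_toReal (measure_ne_top _ _)).comp (tendsto_measure_iInter_atTop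
    (fun n => ?_) (fun m n hmn q (hq : dist _ _ < _) => ?_) ⟨0, measure_ne_top _ _⟩)
  · exact (measurableSet_lt measurable_dist measurable_const).nullMeasurableSet
  · exact lt_of_lt_of_le hq (Nat.one_div_le_one_div hmn)

theorem sub_le_mul_measureReal_diagonal (hr : 0 ≤ r)
    (hf : ∀ n : ℕ, f ∈ separatingMaps K P c r (1 / (n + 1))) (hμ : μ ∈ P) (hν : ν ∈ P)
    (hfst : MeasurePreserving Prod.fst lam μ) (hsnd : MeasurePreserving Prod.snd lam ν)
    (hlam : ∀ᵐ q ∂lam, f q.1 = f q.2) : r - 2 * c ≤ r * lam.real (Set.diagonal X) :=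
  ge_of_tendsto' ((tendsto_measureReal_dist_lt_diagonal lam).const_mul r) fun n =>
    sub_le_mul_measureReal_dist_lt hr (hf n) hμ hν hfst hsnd hlam

end Joining

section CondDistrib

open ProbabilityTheory

variable {X Y Z Ω : Type*} [MeasurableSpace X] [MeasurableSpace Y] [MeasurableSpace Z]
  [MeasurableSpace Ω]

theorem compProd_map_left {μ : Measure Y} [SFinite μ] (κ : Kernel Z Ω) [IsSFiniteKernel κ]
    {S : Y → Z} (hS : Measurable S) :
    μ.map S ⊗ₘ κ = (μ ⊗ₘ κ.comap S hS).map (Prod.map S id) := by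
  ext A hA
  rw [Measure.map_apply (hS.prodMap measurable_id) hA, Measure.compProd_apply hA,
    Measure.compProd_apply (hS.prodMap measurable_id hA),
    lintegral_map (Kernel.measurable_kernel_prodMk_left hA) hS]
  rfl

variable [StandardBorelSpace Ω] [Nonempty Ω]

theorem condDistrib_measurableEquiv_comp (S : Y ≃ᵐ Z) {μ : Measure X} [IsFiniteMeasure μ]
    {f : X → Y} {g : X → Ω} (hf : Measurable f) (hg : AEMeasurable g μ) :
    (condDistrib g (S ∘ f) μ).comap S S.measurable =ᵐ[μ.map f] condDistrib g f μ := by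
  refine (condDistrib_ae_eq_of_measure_eq_compProd f hg ?_).symm
  refine (S.prodCongr (MeasurableEquiv.refl Ω)).map_measurableEquiv_injective ?_
  calc (μ.map fun x => (f x, g x)).map (Prod.map S id)
      = μ.map fun x => ((S ∘ f) x, g x) :=
        AEMeasurable.map_map_of_aemeasurable (S.measurable.prodMap measurable_id).aemeasurable
          (hf.aemeasurable.prodMk hg)
    _ = μ.map (S ∘ f) ⊗ₘ condDistrib g (S ∘ f) μ := (compProd_map_condDistrib hg).symm
    _ = (μ.map f ⊗ₘ (condDistrib g (S ∘ f) μ).comap S S.measurable).map (Prod.map S id) := by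
        rw [← Measure.map_map S.measurable hf, compProd_map_left]

theorem map_condDistrib_id_of_semiconj {μ : Measure Ω} [IsFiniteMeasure μ] {T : Ω → Ω}
    (hT : MeasurePreserving T μ μ) (S : Y ≃ᵐ Y) {f : Ω → Y} (hf : Measurable f)
    (hfT : Function.Semiconj f T S) :
    (condDistrib id f μ).map T =ᵐ[μ.map f] (condDistrib id f μ).comap S S.measurable := by
  have hmap : (μ.map f).map S = μ.map (f ∘ T) := by
    rw [Measure.map_map S.measurable hf, hfT.comp_eq]
  have hT_comp : condDistrib T (f ∘ T) μ =ᵐ[(μ.map f).map S] condDistrib id f μ := by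
    have h := condDistrib_map (ν := μ) (f := T) (X := f) (Y := id) hf.aemeasurable
      aemeasurable_id hT.aemeasurable
    simp only [hT.map_eq, Function.id_comp] at h
    exact hmap ▸ h.symm
  calc (condDistrib id f μ).map T
      =ᵐ[μ.map f] condDistrib T f μ := (condDistrib_comp f aemeasurable_id hT.measurable).symm
    _ =ᵐ[μ.map f] (condDistrib T (S ∘ f) μ).comap S S.measurable :=
        (condDistrib_measurableEquiv_comp S hf hT.aemeasurable).symm
    _ =ᵐ[μ.map f] (condDistrib id f μ).comap S S.measurable := by
        rw [← hfT.comp_eq]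
        exact ae_of_ae_map S.measurable.aemeasurable hT_comp

theorem ae_condDistrib_id_eq {μ : Measure Ω} [IsFiniteMeasure μ] [MeasurableEq Y] {f : Ω → Y}
    (hf : Measurable f) : ∀ᵐ y ∂μ.map f, ∀ᵐ x ∂condDistrib id f μ y, f x = y := by
  refine Measure.ae_ae_of_ae_compProd (p := fun q => f q.2 = q.1) ?_
  have hmeas : MeasurableSet {q : Y × Ω | f q.2 = q.1} :=
    measurableSet_eq_fun (hf.comp measurable_snd) measurable_fst
  rw [compProd_map_condDistrib aemeasurable_id,
    ae_map_iff (hf.prodMk measurable_id).aemeasurable hmeas]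
  exact .of_forall fun _ => rfl

end CondDistrib

section SelfJoining

open ProbabilityTheory

variable {X Y : Type*} [MeasurableSpace X] [StandardBorelSpace X] [Nonempty X]
  [MeasurableSpace Y]

/-- The relatively independent self-joining of `μ` over the map `f`, obtained by integrating the
squares of the disintegration of `μ` along the fibres of `f`. -/
noncomputable def selfJoining (μ : Measure X) [IsFiniteMeasure μ] (f : X → Y) :
    Measure (X × X) :=
  (condDistrib id f μ ×ₖ condDistrib id f μ) ∘ₘ μ.map f

variable {μ : Measure X} [IsProbabilityMeasure μ] {f : X → Y}

theorem isProbabilityMeasure_selfJoining (hf : Measurable f) :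
    IsProbabilityMeasure (selfJoining μ f) := by
  have := Measure.isProbabilityMeasure_map (μ := μ) hf.aemeasurable
  rw [selfJoining]
  infer_instance

theorem ae_selfJoining_eq [MeasurableEq Y] (hf : Measurable f) :
    ∀ᵐ q ∂selfJoining μ f, f q.1 = f q.2 := by
  refine Measure.ae_comp_of_ae_ae
    (measurableSet_eq_fun (hf.comp measurable_fst) (hf.comp measurable_snd)) ?_
  filter_upwards [ae_condDistrib_id_eq (μ := μ) hf] with y hy
  rw [Kernel.prod_apply]
  filter_upwards [Measure.quasiMeasurePreserving_fst.ae hy,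
    Measure.quasiMeasurePreserving_snd.ae hy] with q hfst hsnd
  exact hfst.trans hsnd.symm

theorem measurePreserving_selfJoining {T : X → X} (hT : MeasurePreserving T μ μ) (S : Y ≃ᵐ Y)
    (hf : Measurable f) (hfT : Function.Semiconj f T S) :
    MeasurePreserving (Prod.map T T) (selfJoining μ f) (selfJoining μ f) := by
  have hTT : Measurable (Prod.map T T) := hT.measurable.prodMap hT.measurable
  have hS : (μ.map f).map S = μ.map f := by
    rw [Measure.map_map S.measurable hf, ← hfT.comp_eq, ← Measure.map_map hf hT.measurable,
      hT.map_eq]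
  refine ⟨hTT, ?_⟩
  set κ := condDistrib id f μ
  calc (selfJoining μ f).map (Prod.map T T)
      = (κ.map T ×ₖ κ.map T) ∘ₘ μ.map f := by
        rw [selfJoining, Measure.map_comp _ _ hTT,
          Kernel.map_prod_map _ _ hT.measurable hT.measurable]
    _ = ((κ ×ₖ κ).comap S S.measurable) ∘ₘ μ.map f := by
        refine Measure.comp_congr ?_
        filter_upwards [map_condDistrib_id_of_semiconj hT S hf hfT] with y hy
        rw [Kernel.prod_apply, hy, ← Kernel.prod_apply, Kernel.comap_prod]
    _ = (κ ×ₖ κ) ∘ₘ (μ.map f).map S := by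
        rw [← Kernel.comp_deterministic_eq_comap, ← Measure.comp_assoc,
          Measure.deterministic_comp_eq_map]
    _ = selfJoining μ f := by rw [hS, selfJoining]

theorem ae_ae_condDistrib_id_eq (hf : Measurable f) (h : ∀ᵐ q ∂selfJoining μ f, q.1 = q.2) :
    ∀ᵐ x ∂μ, ∀ᵐ x' ∂condDistrib id f μ (f x), x = x' := by
  set κ := condDistrib id f μ
  have hprod : ∀ᵐ y ∂μ.map f, ∀ᵐ x ∂κ y, ∀ᵐ x' ∂κ y, x = x' := by
    filter_upwards [Measure.ae_ae_of_ae_comp h] with y hy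
    rw [Kernel.prod_apply] at hy
    exact Measure.ae_ae_of_ae_prod hy
  have hmeas : MeasurableSet {q : Y × X | ∀ᵐ x' ∂κ q.1, q.2 = x'} := by
    have hne : MeasurableSet {z : (Y × X) × X | z.1.2 = z.2}ᶜ :=
      (measurableSet_eq_fun measurable_fst.snd measurable_snd).compl
    exact Kernel.measurable_kernel_prodMk_left (κ := κ.comap Prod.fst measurable_fst) hne
      (measurableSet_singleton 0)
  have hcompProd : ∀ᵐ q ∂(μ.map f ⊗ₘ κ), ∀ᵐ x' ∂κ q.1, q.2 = x' :=
    Measure.ae_compProd_of_ae_ae hmeas hprod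
  rw [compProd_map_condDistrib aemeasurable_id] at hcompProd
  exact ae_of_ae_map (hf.prodMk measurable_id).aemeasurable hcompProd

theorem exists_injOn_of_ae_selfJoining_eq (hf : Measurable f)
    (h : ∀ᵐ q ∂selfJoining μ f, q.1 = q.2) : ∃ A ∈ ae μ, Set.InjOn f A := by
  refine ⟨_, ae_ae_condDistrib_id_eq hf h, fun x hx y hy hxy => ?_⟩
  have hx_ae : ∀ᵐ z ∂condDistrib id f μ (f x), x = z := hx
  have hy_ae : ∀ᵐ z ∂condDistrib id f μ (f x), y = z := hxy ▸ hy
  obtain ⟨z, hxz, hyz⟩ := (hx_ae.and hy_ae).exists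
  exact hxz.trans hyz.symm

end SelfJoining

section MeasureIso

variable {Γ : Type*} [Group Γ] [Countable Γ] {X : Type*} [TopologicalSpace X] [MeasurableSpace X]
  [BorelSpace X] {T : Γ →* (X ≃ₜ X)} {μ : Measure X} {A : Set X}

theorem exists_invariant_subset_of_mem_ae (hμ : ∀ γ, μ.map (T γ) = μ) (hA : A ∈ ae μ) :
    ∃ X₀ ⊆ A, MeasurableSet X₀ ∧ μ X₀ᶜ = 0 ∧ ∀ γ, T γ '' X₀ = X₀ := by
  obtain ⟨N, hAN, hN, hN_null⟩ := exists_measurable_superset_of_null (mem_ae_iff.1 hA)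
  have hTT : ∀ γ γ' x, T γ (T γ' x) = T (γ * γ') x := fun γ γ' x => by rw [map_mul]; rfl
  have hforward : ∀ γ, ∀ x ∈ ⋂ γ, T γ ⁻¹' Nᶜ, T γ x ∈ ⋂ γ, T γ ⁻¹' Nᶜ := fun γ x hx =>
    Set.mem_iInter.2 fun γ' => by
      rw [Set.mem_preimage, hTT]
      exact Set.mem_iInter.1 hx _
  refine ⟨⋂ γ, T γ ⁻¹' Nᶜ, fun x hx => ?_, .iInter fun γ => (T γ).measurable hN.compl, ?_,
    fun γ => ?_⟩
  · exact Set.compl_subset_comm.1 hAN (by simpa using Set.mem_iInter.1 hx 1)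
  · simp only [Set.compl_iInter, Set.preimage_compl, compl_compl]
    refine measure_iUnion_null fun γ => ?_
    rw [← Measure.map_apply (T γ).measurable hN, hμ, hN_null]
  · refine Set.Subset.antisymm (Set.image_subset_iff.2 (hforward γ)) fun x hx =>
      ⟨T γ⁻¹ x, hforward _ x hx, ?_⟩
    rw [hTT, mul_inv_cancel, map_one]
    rfl

theorem inducesMeasureIso_of_injOn [StandardBorelSpace X] {Y : Type*} [TopologicalSpace Y]
    [MeasurableSpace Y] [MeasurableSpace.CountablySeparated Y] {S : Γ →* (Y ≃ₜ Y)}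
    (hμ : ∀ γ, μ.map (T γ) = μ) {f : X → Y} (hf : Measurable f)
    (hequiv : ∀ γ x, f (T γ x) = S γ (f x)) (hA : A ∈ ae μ) (hinj : Set.InjOn f A) :
    InducesMeasureIso T S μ f := by
  obtain ⟨X₀, hX₀A, hX₀, hX₀_conull, hTX₀⟩ := exists_invariant_subset_of_mem_ae hμ hA
  have hinj₀ : Set.InjOn f X₀ := hinj.mono hX₀A
  have hrange : Set.range (X₀.domRestrict f) = f '' X₀ := Set.range_domRestrict f X₀
  have := hX₀.standardBorel
  have hemb : MeasurableEmbedding (X₀.domRestrict f) :=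
    (hf.comp measurable_subtype_coe).measurableEmbedding (Set.injOn_iff_injective.1 hinj₀)
  refine ⟨hf, X₀, Set.range (X₀.domRestrict f), hX₀, hemb.measurableSet_range, hX₀_conull, ?_, hTX₀,
    fun γ => ?_, fun γ x _ => hequiv γ x, hemb.equivRange, fun x => ?_⟩
  · rw [Measure.map_apply hf hemb.measurableSet_range.compl, hrange]
    exact measure_mono_null (fun x hx hx₀ => hx ⟨x, hx₀, rfl⟩) hX₀_conull
  · rw [hrange, Set.image_image]
    simp_rw [← hequiv]
    rw [← Set.image_image f, hTX₀]
  · rw [hemb.equivRange_apply]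
    rfl

end MeasureIso

section Orbit

variable {Γ : Type*} [Group Γ] {X K : Type*} [TopologicalSpace X] [TopologicalSpace K]

theorem orbitMap_equivariant (T : Γ →* (X ≃ₜ X)) (f : X → K) (γ : Γ) (x : X) :
    orbitMap T f (T γ x) = shift Γ K γ (orbitMap T f x) := by
  funext γ'
  change f (T γ'⁻¹ (T γ x)) = f (T (γ⁻¹ * γ')⁻¹ x)
  rw [mul_inv_rev, inv_inv, map_mul]
  rfl

theorem continuous_orbitMap (T : Γ →* (X ≃ₜ X)) {f : X → K} (hf : Continuous f) :
    Continuous (orbitMap T f) :=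
  continuous_pi fun γ => hf.comp (T γ⁻¹).continuous

end Orbit

section InvProb

variable {Γ : Type*} [Group Γ] {X Z : Type*} [TopologicalSpace X] [MeasurableSpace X]
  [BorelSpace X] [MeasurableSpace Z] {T : Γ →* (X ≃ₜ X)}

theorem mem_invProb_of_measurePreserving {ν : Measure Z} {R : Γ → Z → Z}
    (hR : ∀ γ, MeasurePreserving (R γ) ν ν) {μ : ProbabilityMeasure X} {π : Z → X}
    (hπ : MeasurePreserving π ν μ) (hπR : ∀ γ, Function.Semiconj π (R γ) (T γ)) :
    μ ∈ invProb T := fun γ => by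
  rw [← hπ.map_eq, Measure.map_map (T γ).measurable hπ.measurable, ← (hπR γ).comp_eq,
    ← Measure.map_map hπ.measurable (hR γ).measurable, (hR γ).map_eq]

end InvProb

section AlmostEmbedding

variable {Γ : Type*} [Group Γ] {X : Type*} [MetricSpace X] [MeasurableSpace X] [BorelSpace X]
  [CompactSpace X] {T : Γ →* (X ≃ₜ X)} {K : Type*} [TopologicalSpace K] {f : C(X, K)} {c r : ℝ}

theorem measure_diagonal_ne_zero {lam : Measure (X × X)} [IsProbabilityMeasure lam]
    (hT : ∀ γ, MeasurePreserving (Prod.map (T γ) (T γ)) lam lam)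
    (hlam : ∀ᵐ q ∂lam, f q.1 = f q.2) (hr : 0 ≤ r) (hc : 2 * c < r)
    (hf : ∀ n : ℕ, f ∈ separatingMaps K (invProb T) c r (1 / (n + 1))) :
    lam (Set.diagonal X) ≠ 0 := by
  intro hdiag
  let lam' : ProbabilityMeasure (X × X) := ⟨lam, inferInstance⟩
  have hfst : MeasurePreserving Prod.fst lam (lam'.map measurable_fst.aemeasurable : Measure X) :=
    measurable_fst.measurePreserving lam
  have hsnd : MeasurePreserving Prod.snd lam (lam'.map measurable_snd.aemeasurable : Measure X) :=
    measurable_snd.measurePreserving lam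
  have hle := sub_le_mul_measureReal_diagonal hr hf
    (mem_invProb_of_measurePreserving hT hfst fun _ _ => rfl)
    (mem_invProb_of_measurePreserving hT hsnd fun _ _ => rfl) hfst hsnd hlam
  rw [measureReal_def, hdiag, ENNReal.toReal_zero, mul_zero] at hle
  linarith

open ProbabilityTheory in
theorem ae_eq_of_forall_mem_separatingMaps {lam : Measure (X × X)} [IsProbabilityMeasure lam]
    (hT : ∀ γ, MeasurePreserving (Prod.map (T γ) (T γ)) lam lam)
    (hlam : ∀ᵐ q ∂lam, f q.1 = f q.2) (hr : 0 ≤ r) (hc : 2 * c < r)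
    (hf : ∀ n : ℕ, f ∈ separatingMaps K (invProb T) c r (1 / (n + 1))) :
    ∀ᵐ q ∂lam, q.1 = q.2 := by
  by_contra hne
  have hoff : lam (Set.diagonal X)ᶜ ≠ 0 := hne
  have hmeas : MeasurableSet (Set.diagonal X)ᶜ := measurableSet_diagonal.compl
  have := cond_isProbabilityMeasure hoff
  have hT_cond : ∀ γ, MeasurePreserving (Prod.map (T γ) (T γ)) lam[|(Set.diagonal X)ᶜ]
      lam[|(Set.diagonal X)ᶜ] := fun γ => by
    have hpre : Prod.map (T γ) (T γ) ⁻¹' (Set.diagonal X)ᶜ = (Set.diagonal X)ᶜ := by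
      ext q
      simp
    have hrestrict := (hT γ).restrict_preimage hmeas
    rw [hpre] at hrestrict
    exact hrestrict.smul_measure _
  refine measure_diagonal_ne_zero hT_cond (cond_absolutelyContinuous.ae_le hlam) hr hc hf ?_
  rw [cond_apply hmeas, Set.compl_inter_self, measure_empty, mul_zero]

theorem isAlmostEmbedding_orbitMap [Countable Γ] [PolishSpace K] [MeasurableSpace K] [BorelSpace K]
    (hr : 0 ≤ r) (hc : 2 * c < r)
    (hf : ∀ n : ℕ, f ∈ separatingMaps K (invProb T) c r (1 / (n + 1))) :
    IsAlmostEmbedding T (shift Γ K) (orbitMap T f) := by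
  have hcont := continuous_orbitMap T f.continuous
  refine ⟨hcont, orbitMap_equivariant T f, fun μ hμ => ?_⟩
  have : Nonempty X := μ.nonempty
  have := isProbabilityMeasure_selfJoining (μ := (μ : Measure X)) hcont.measurable
  have hfibre : ∀ᵐ q ∂selfJoining (μ : Measure X) (orbitMap T f), f q.1 = f q.2 := by
    filter_upwards [ae_selfJoining_eq hcont.measurable] with q hq
    simpa [orbitMap] using congrFun hq 1
  have hT : ∀ γ, MeasurePreserving (Prod.map (T γ) (T γ))
      (selfJoining (μ : Measure X) (orbitMap T f))
      (selfJoining (μ : Measure X) (orbitMap T f)) := fun γ =>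
    measurePreserving_selfJoining ⟨(T γ).measurable, hμ γ⟩ (shift Γ K γ).toMeasurableEquiv
      hcont.measurable (orbitMap_equivariant T f γ)
  obtain ⟨A, hA, hinj⟩ := exists_injOn_of_ae_selfJoining_eq hcont.measurable
    (ae_eq_of_forall_mem_separatingMaps hT hfibre hr hc hf)
  exact inducesMeasureIso_of_injOn hμ hcont.measurable (orbitMap_equivariant T f) hA hinj

end AlmostEmbedding

end DynDim

theorem theorem10p3 {Γ : Type*} [Group Γ] [Countable Γ]
    {X : Type*} [MetricSpace X] [CompactSpace X] [MeasurableSpace X] [BorelSpace X]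
    (T : Γ →* (X ≃ₜ X)) (d : ℕ)
    (hd : DynDim.dimSys T < (((d : ℝ) / 2 : ℝ) : EReal)) :
    ∃ G : Set C(X, Fin d → unitInterval), IsGδ G ∧ Dense G ∧
      ∀ f ∈ G, DynDim.IsAlmostEmbedding T (DynDim.shift Γ (Fin d → unitInterval))
        (DynDim.orbitMap T f) := by
  obtain ⟨c, hTc, hcd⟩ := EReal.lt_iff_exists_real_btwn.1 hd
  have hc : 2 * c < d := by linarith [EReal.coe_lt_coe_iff.1 hcd]
  let G : ℕ → Set C(X, Fin d → unitInterval) := fun n =>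
    DynDim.separatingMaps (Fin d → unitInterval) (DynDim.invProb T) c d (1 / ((n : ℝ) + 1))
  have hopen : ∀ n, IsOpen (G n) := fun n => DynDim.isOpen_separatingMaps _ _ _ _
  have hdense : ∀ n, Dense (G n) := fun n =>
    DynDim.dense_separatingMaps hTc d Nat.one_div_pos_of_nat
  exact ⟨⋂ n, G n, .iInter_of_isOpen hopen, dense_iInter_of_isOpen hopen hdense, fun f hf =>
    DynDim.isAlmostEmbedding_orbitMap d.cast_nonneg hc (Set.mem_iInter.1 hf)⟩
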